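/- Let $W$ be a standard Brownian motion and let $\xi\ge 0$ be a random variable independent of $W$. For $k\ge 0$ put $\tau^{(k)}=\inf\{t>0:\ \xi+W_t<kt\}$, with $\inf\emptyset=\infty$. For a non-negative random variable $\tau$ we say that $(\tau,\xi,k)$ is a solution of the generalized Shiryaev problem if $P(\tau^{(k)}\le t)=P(\tau\le t)$ for all $t\ge 0$. For a non-negative random variable $\eta$ and $a>0$ let $\eta_a$ denote a random variable (on some probability space) with Laplace transform $$E\bigl[e^{-s\eta_a}\bigr]=\frac{E\bigl[e^{-(a+s)\eta}\bigr]}{E\bigl[e^{-a\eta}\bigr]},\qquad s\ge 0;$$ such $\eta_a$, $a>0$, form the Esscher family $\mathcal E(\eta)$ generated by $\eta$. Suppose that $(\tau,\xi,k_0)$ is a solution of the generalized Shiryaev problem for some $k_0\ge 0$. Let $k>k_0$, $\Delta=k-k_0$, $\alpha=\Delta k_0+\Delta^2/2$ and $\beta=\Delta$. Then there exist $\tau_\alpha\in\mathcal E(\tau)$ and $\xi_\beta\in\mathcal E(\xi)$ such that $(\tau_\alpha,\xi_\beta,k)$ is a solution of the generalized Shiryaev problem; moreover, any random variables $\tau_\alpha\in\mathcal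 E(\tau)$ and $\xi_\beta\in\mathcal E(\xi)$ with these parameters, the latter independent of the driving Brownian motion, form such a solution. -/

import Mathlib

open MeasureTheory ProbabilityTheory
open scoped NNReal ENNReal

universe u v w z

namespace GSP

/-- The first hitting time `inf {t > 0 : ξ + W_t < k t}` of the boundary `t ↦ k t` by the process
`ξ + W_t`; it is `∞` on paths that never pass below the boundary. -/
noncomputable def firstHittingTime {Ω : Type*} (W : ℝ≥0 → Ω → ℝ) (ξ : Ω → ℝ) (k : ℝ) (ω : Ω) :
    ℝ≥0∞ :=
  ⨅ (t : ℝ≥0) (_ : 0 < t ∧ ξ ω + W t ω < k * t), (t : ℝ≥0∞)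

/-- The Laplace transform `s ↦ E[exp(-s η)]` of a real random variable. -/
noncomputable def laplace {Ω : Type*} [MeasurableSpace Ω] (η : Ω → ℝ) (P : Measure Ω) (s : ℝ) :
    ℝ :=
  ∫ ω, Real.exp (-s * η ω) ∂P

/-- `(ξ, τ, k)` solves the generalized Shiryaev problem. Here `W` is a standard Brownian motion,
`ξ` is an almost surely non-negative random variable independent of `W`, `k ≥ 0` is the slope of
the boundary, and the first hitting time of `t ↦ k t` by `ξ + W` has the distribution function of
the (non-negative, real-valued) random variable `τ`, which may live on another probability space. -/
structure IsSolution {Ω Ω₀ : Type*} [MeasurableSpace Ω] [MeasurableSpace Ω₀]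
    (P : Measure Ω) (W : ℝ≥0 → Ω → ℝ) (ξ : Ω → ℝ) (P₀ : Measure Ω₀) (τ : Ω₀ → ℝ) (k : ℝ) :
    Prop where
  isProbabilityMeasure : IsProbabilityMeasure P
  isProbabilityMeasure_target : IsProbabilityMeasure P₀
  brownian : IsBrownianReal W P
  aemeasurable_start : AEMeasurable ξ P
  start_nonneg : ∀ᵐ ω ∂P, 0 ≤ ξ ω
  indep : IndepFun ξ (fun ω t ↦ W t ω) P
  slope_nonneg : 0 ≤ k
  aemeasurable_target : AEMeasurable τ P₀
  target_nonneg : ∀ᵐ ω ∂P₀, 0 ≤ τ ω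
  cdf_eq : ∀ t : ℝ≥0, P {ω | firstHittingTime W ξ k ω ≤ t} = P₀ {ω | τ ω ≤ t}

/-- `ηa` (on `(Ω', P')`) is the member with parameter `a > 0` of the Esscher family generated by
`η` (on `(Ω, P)`): its Laplace transform at `s ≥ 0` is `E[exp(-(a+s) η)] / E[exp(-a η)]`. -/
structure IsEsscher {Ω Ω' : Type*} [MeasurableSpace Ω] [MeasurableSpace Ω'] (a : ℝ)
    (P : Measure Ω) (η : Ω → ℝ) (P' : Measure Ω') (ηa : Ω' → ℝ) : Prop where
  param_pos : 0 < a
  isProbabilityMeasure : IsProbabilityMeasure P'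
  aemeasurable : AEMeasurable ηa P'
  laplace_eq : ∀ s : ℝ, 0 ≤ s → laplace ηa P' s = laplace η P (a + s) / laplace η P a

end GSP

/-! Write `Δ = k - k₀`, `α = Δ k₀ + Δ² / 2`, and let `T_k` be the hitting time from a fixed start `x
≥ 0`. By Girsanov, passing from slope `k₀` to `k` weights paths by `exp (-Δ W_T - Δ² T / 2)`. By
continuity `x + W_T = k₀ T` at `T = T_{k₀}`, so the weight is `exp (Δ x - α T)` and `E[exp (-c T_k)]
= exp (Δ x) E[exp (-(c + α) T_{k₀})]` (`lintegral_discount_hit_eq`). If the start has the law of `ξ`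
tilted by `exp (-Δ x)`, this factor cancels `exp (Δ x)`, and integration over `x` gives `L_τ (α + c)
/ L_ξ (Δ)` (`IsSolution.lintegral_discount_of_isEsscher`). Since `k > 0`, the line is hit almost
surely; `c = 0` then yields `L_τ (α) = L_ξ (Δ)`, so the new hitting time belongs to the Esscher
family of `τ`. Uniqueness of Laplace transforms (`ext_of_laplace`) extends this to every choice of
Esscher variables. The Girsanov formula is obtained from Gaussian increments on grids, followed by
refinement of the mesh. -/

namespace GSP

open Filter Topology

/-! ### Hitting times of a line along continuous paths, and their grid approximations. -/

section Paths

/-- The first time the path `x + w` falls below the line of slope `k`. -/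
noncomputable def hit (x k : ℝ) (w : ℝ≥0 → ℝ) : ℝ≥0∞ :=
  ⨅ (t : ℝ≥0) (_ : 0 < t ∧ x + w t < k * t), (t : ℝ≥0∞)

lemma firstHittingTime_eq_hit {Ω : Type*} (W : ℝ≥0 → Ω → ℝ) (ξ : Ω → ℝ) (k : ℝ) (ω : Ω) :
    firstHittingTime W ξ k ω = hit (ξ ω) k (fun t ↦ W t ω) := rfl

lemma hit_lt_iff {x k : ℝ} {w : ℝ≥0 → ℝ} {r : ℝ≥0∞} :
    hit x k w < r ↔ ∃ t : ℝ≥0, (0 < t ∧ x + w t < k * t) ∧ (t : ℝ≥0∞) < r := by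
  simp [hit, iInf_lt_iff]

lemma hit_le {x k : ℝ} {w : ℝ≥0 → ℝ} {t : ℝ≥0} (h0 : 0 < t) (h : x + w t < k * t) :
    hit x k w ≤ t := iInf₂_le t ⟨h0, h⟩

/-- `j` is the index of the first point of the grid `h, 2h, …` at which the path `x + w` is below
the line of slope `k`. -/
def IsGridHit (x k : ℝ) (h : ℝ≥0) (w : ℝ≥0 → ℝ) (j : ℕ) : Prop :=
  0 < j ∧ x + w (j * h) < k * (j * h) ∧ ∀ i : ℕ, 0 < i → i < j → k * (i * h) ≤ x + w (i * h)

lemma IsGridHit.unique {x k : ℝ} {h : ℝ≥0} {w : ℝ≥0 → ℝ} {i j : ℕ} (hi : IsGridHit x k h w i)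
    (hj : IsGridHit x k h w j) : i = j := by
  rcases lt_trichotomy i j with hij | hij | hij
  · exact absurd hi.2.1 (not_lt.2 (hj.2.2 i hi.1 hij))
  · exact hij
  · exact absurd hj.2.1 (not_lt.2 (hi.2.2 j hj.1 hij))

lemma IsGridHit.le_hit {x k : ℝ} {h : ℝ≥0} (hh : 0 < h) {w : ℝ≥0 → ℝ} {j : ℕ}
    (hj : IsGridHit x k h w j) : hit x k w ≤ (j * h : ℝ≥0) :=
  hit_le (by have := hj.1; positivity) (by simpa using hj.2.1)

lemma exists_isGridHit {x k : ℝ} {h : ℝ≥0} {w : ℝ≥0 → ℝ} {j : ℕ} (h0 : 0 < j)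
    (hj : x + w (j * h) < k * (j * h)) : ∃ i ≤ j, IsGridHit x k h w i := by
  classical
  have hex : ∃ i : ℕ, 0 < i ∧ x + w (i * h) < k * (i * h) := ⟨j, h0, hj⟩
  refine ⟨Nat.find hex, Nat.find_min' hex ⟨h0, hj⟩, (Nat.find_spec hex).1, (Nat.find_spec hex).2,
    fun i hi hlt ↦ ?_⟩
  have := Nat.find_min hex hlt
  simp only [not_and, not_lt] at this
  exact this hi

/-- The value of `φ` at the first grid point where the path is below the line. -/
noncomputable def gridValue (x k : ℝ) (h : ℝ≥0) (w : ℝ≥0 → ℝ) (φ : ℝ≥0 → ℝ≥0∞) : ℝ≥0∞ :=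
  open Classical in ∑' j : ℕ, if IsGridHit x k h w j then φ (j * h) else 0

lemma IsGridHit.gridValue_eq {x k : ℝ} {h : ℝ≥0} {w : ℝ≥0 → ℝ} {j : ℕ}
    (hj : IsGridHit x k h w j) (φ : ℝ≥0 → ℝ≥0∞) : gridValue x k h w φ = φ (j * h) := by
  classical
  rw [gridValue, tsum_eq_single j, if_pos hj]
  intro i hi
  rw [if_neg]
  exact fun h ↦ hi (h.unique hj)

lemma gridValue_eq_zero {x k : ℝ} {h : ℝ≥0} {w : ℝ≥0 → ℝ}
    (hw : ∀ j, ¬ IsGridHit x k h w j) (φ : ℝ≥0 → ℝ≥0∞) : gridValue x k h w φ = 0 := by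
  simp [gridValue, hw]

lemma gridValue_le {x k : ℝ} {h : ℝ≥0} {w : ℝ≥0 → ℝ} {φ : ℝ≥0 → ℝ≥0∞} {c : ℝ≥0∞}
    (hφ : ∀ t, φ t ≤ c) : gridValue x k h w φ ≤ c := by
  by_cases hw : ∃ j, IsGridHit x k h w j
  · obtain ⟨j, hj⟩ := hw
    rw [hj.gridValue_eq]
    exact hφ _
  · rw [gridValue_eq_zero (not_exists.1 hw)]
    exact zero_le

/-- The mesh of the `n`-th grid. -/
noncomputable def mesh (n : ℕ) : ℝ≥0 := 1 / (n + 1)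

lemma mesh_pos (n : ℕ) : 0 < mesh n := by unfold mesh; positivity

lemma tendsto_mesh : Tendsto mesh atTop (𝓝 0) := tendsto_one_div_add_atTop_nhds_zero_nat

/-- The grid point with index `⌊t / h⌋ + 1` lies in `(t, t + h]`; the `+ 1` also keeps the index
positive, as `IsGridHit` demands. -/
lemma eventually_grid_mem {U : Set ℝ≥0} {t : ℝ≥0} (hU : U ∈ 𝓝 t) :
    ∀ᶠ n in atTop, ((⌊t / mesh n⌋₊ + 1 : ℕ) * mesh n : ℝ≥0) ∈ U := by
  have : Tendsto (fun n ↦ ((⌊t / mesh n⌋₊ + 1 : ℕ) * mesh n : ℝ≥0)) atTop (𝓝 t) := by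
    refine tendsto_of_tendsto_of_tendsto_of_le_of_le (g := fun _ ↦ t) (h := fun n ↦ t + mesh n)
      tendsto_const_nhds (by simpa using tendsto_mesh.const_add t) (fun n ↦ ?_) (fun n ↦ ?_)
    · have := (Nat.lt_floor_add_one (t / mesh n)).le
      rw [div_le_iff₀ (mesh_pos n)] at this
      simpa using this
    · have := Nat.floor_le (a := t / mesh n) zero_le
      rw [le_div_iff₀ (mesh_pos n)] at this
      simpa [add_mul] using this
  exact this hU

/-- Below any upper bound of the hitting time, fine grids see a hit. -/
lemma eventually_exists_isGridHit {x k : ℝ} {w : ℝ≥0 → ℝ} (hw : Continuous w) {r : ℝ≥0}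
    (hr : hit x k w < r) :
    ∀ᶠ n in atTop, ∃ j, IsGridHit x k (mesh n) w j ∧ (j * mesh n : ℝ≥0) < r := by
  obtain ⟨t, ⟨ht0, ht⟩, htr⟩ := hit_lt_iff.1 hr
  have h1 : {s : ℝ≥0 | x + w s < k * s} ∈ 𝓝 t :=
    (isOpen_lt (by fun_prop) (by fun_prop)).mem_nhds ht
  have h2 : Set.Iio r ∈ 𝓝 t := Iio_mem_nhds (by exact_mod_cast htr)
  filter_upwards [eventually_grid_mem (inter_mem h1 h2)] with n hn
  obtain ⟨hn1, hn2⟩ := hn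
  obtain ⟨i, hi, hi'⟩ := exists_isGridHit (x := x) (k := k) (h := mesh n) (w := w)
    (Nat.succ_pos ⌊t / mesh n⌋₊) (by simpa using hn1)
  refine ⟨i, hi', lt_of_le_of_lt ?_ hn2⟩
  gcongr

/-- A grid hit never precedes the true hit, and fine grids have one just after it. So the first grid
hit converges to the hitting time from the right; if there is no true hit, there is no grid hit
either. -/
lemma tendsto_gridValue {x k : ℝ} {w : ℝ≥0 → ℝ} (hw : Continuous w) {φ : ℝ≥0 → ℝ≥0∞}
    (hφ : Continuous φ) :
    Tendsto (fun n ↦ gridValue x k (mesh n) w φ) atTop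
      (𝓝 (if hit x k w = ∞ then 0 else φ (hit x k w).toNNReal)) := by
  split_ifs with hT
  · have : ∀ n, gridValue x k (mesh n) w φ = 0 := fun n ↦
      gridValue_eq_zero (fun j hj ↦ ENNReal.coe_ne_top
        (top_le_iff.1 (hT ▸ hj.le_hit (mesh_pos n)))) φ
    simp [this]
  · lift hit x k w to ℝ≥0 using hT with T hT'
    rw [ENNReal.toNNReal_coe]
    intro V hV
    rw [mem_map]
    have hV' := (hφ.tendsto T) hV
    obtain ⟨r, hr, hrV⟩ := exists_Ico_subset_of_mem_nhds hV' ⟨T + 1, by simp⟩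
    filter_upwards [eventually_exists_isGridHit hw (x := x) (k := k) (r := r)
      (by rw [← hT']; exact_mod_cast hr)] with n ⟨j, hj, hjr⟩
    rw [Set.mem_preimage, hj.gridValue_eq]
    refine hrV ⟨?_, hjr⟩
    have := hj.le_hit (mesh_pos n)
    rw [← hT'] at this
    exact_mod_cast this

/-- Before the hitting time the path is not below the line, while arbitrarily soon afterwards it is;
continuity forces equality. -/
lemma add_apply_hit {x k : ℝ} {w : ℝ≥0 → ℝ} (hw : Continuous w) (hx : 0 ≤ x) (h0 : w 0 = 0)
    (hT : hit x k w ≠ ∞) : x + w (hit x k w).toNNReal = k * (hit x k w).toNNReal := by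
  have hlt : ∀ t : ℝ≥0, 0 < t → t < (hit x k w).toNNReal → k * t ≤ x + w t := by
    intro t ht htT
    by_contra! hc
    have := hit_le ht hc
    rw [← ENNReal.coe_toNNReal hT] at this
    exact absurd htT (not_lt.2 (by exact_mod_cast this))
  have hfreq : ∀ r : ℝ≥0, (hit x k w).toNNReal < r → ∃ t : ℝ≥0, (hit x k w).toNNReal ≤ t ∧ t < r ∧
      x + w t < k * t := by
    intro r hr
    have : hit x k w < r := by rw [← ENNReal.coe_toNNReal hT]; exact_mod_cast hr
    obtain ⟨t, ⟨ht0, ht⟩, htr⟩ := hit_lt_iff.1 this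
    refine ⟨t, ?_, by exact_mod_cast htr, ht⟩
    have := hit_le ht0 ht
    rw [← ENNReal.coe_toNNReal hT] at this
    exact_mod_cast this
  generalize (hit x k w).toNNReal = T at *
  apply le_antisymm
  · by_contra! hc
    have h1 : {s : ℝ≥0 | k * s < x + w s} ∈ 𝓝 T :=
      (isOpen_lt (by fun_prop) (by fun_prop)).mem_nhds hc
    obtain ⟨r, hr, hrV⟩ := exists_Ico_subset_of_mem_nhds h1 ⟨T + 1, by simp⟩
    obtain ⟨t, h1, h2, h3⟩ := hfreq r hr
    exact absurd h3 (not_lt.2 (le_of_lt (hrV ⟨h1, h2⟩)))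
  -- At `T = 0` there are no earlier times to use; the bound is exactly the non-negativity of the
  -- start.
  · rcases eq_or_ne T 0 with rfl | hT0
    · simpa [h0] using hx
    · by_contra! hc
      have h1 : {s : ℝ≥0 | x + w s < k * s} ∈ 𝓝 T :=
        (isOpen_lt (by fun_prop) (by fun_prop)).mem_nhds hc
      obtain ⟨l, hl, hlV⟩ := exists_Ioc_subset_of_mem_nhds h1 ⟨0, pos_iff_ne_zero.2 hT0⟩
      obtain ⟨t, ht, htT⟩ := exists_between hl
      exact absurd (hlV ⟨ht, htT.le⟩) (not_lt.2 (hlt t (lt_of_le_of_lt zero_le ht) htT))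

/-- The discount factor `exp (-c T)`, zero at `T = ∞`. -/
noncomputable def discount (c : ℝ) (T : ℝ≥0∞) : ℝ≥0∞ :=
  if T = ∞ then 0 else ENNReal.ofReal (Real.exp (-c * T.toNNReal))

lemma measurable_discount (c : ℝ) : Measurable (discount c) := by
  unfold discount
  refine Measurable.ite (measurableSet_singleton _) measurable_const ?_
  fun_prop

lemma discount_le_one {c : ℝ} (hc : 0 ≤ c) (T : ℝ≥0∞) : discount c T ≤ 1 := by
  unfold discount
  split_ifs
  · exact zero_le
  · rw [ENNReal.ofReal_le_one, Real.exp_le_one_iff]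
    have : 0 ≤ c * T.toNNReal := by positivity
    linarith

end Paths

/-! ### Change of drift for finitely many Gaussian increments. -/

section DriftOnGrids

/-- It suffices to test boxes. There the indicator times the density factorises, and the coordinates
are independent under the product measure. -/
lemma pi_withDensity {ι : Type*} [Fintype ι] {X : ι → Type*} [∀ i, MeasurableSpace (X i)]
    (μ : ∀ i, Measure (X i)) [∀ i, IsProbabilityMeasure (μ i)] {ρ : ∀ i, X i → ℝ≥0∞}
    (hρ : ∀ i, Measurable (ρ i)) [∀ i, SigmaFinite ((μ i).withDensity (ρ i))] :
    Measure.pi (fun i ↦ (μ i).withDensity (ρ i)) =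
      (Measure.pi μ).withDensity (fun y ↦ ∏ i, ρ i (y i)) := by
  refine Measure.pi_eq fun s hs ↦ ?_
  rw [withDensity_apply _ (.univ_pi hs), ← lintegral_indicator (.univ_pi hs)]
  have h1 : ∀ y, (Set.univ.pi s).indicator (fun y : ∀ i, X i ↦ ∏ i, ρ i (y i)) y =
      ∏ i, (s i).indicator (ρ i) (y i) := by
    intro y
    by_cases hy : y ∈ Set.univ.pi s
    · rw [Set.indicator_of_mem hy]
      exact Finset.prod_congr rfl fun i _ ↦ by rw [Set.indicator_of_mem (hy i trivial)]
    · rw [Set.indicator_of_notMem hy]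
      simp only [Set.mem_pi, Set.mem_univ, forall_const, not_forall] at hy
      obtain ⟨i, hi⟩ := hy
      exact (Finset.prod_eq_zero (Finset.mem_univ i) (Set.indicator_of_notMem hi _)).symm
  have hm : ∀ i, Measurable ((s i).indicator (ρ i)) := fun i ↦ (hρ i).indicator (hs i)
  simp_rw [h1]
  rw [lintegral_prod_eq_prod_lintegral_of_indepFun Finset.univ
    (fun i (y : ∀ i, X i) ↦ (s i).indicator (ρ i) (y i))
    (iIndepFun_pi fun i ↦ (hm i).aemeasurable) (fun i ↦ (hm i).comp (measurable_pi_apply i))]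
  refine Finset.prod_congr rfl fun i _ ↦ ?_
  rw [(measurePreserving_eval μ i).lintegral_comp (hm i), lintegral_indicator (hs i),
    withDensity_apply _ (hs i)]

lemma gaussianReal_map_sub_eq_withDensity {h : ℝ≥0} (hh : h ≠ 0) (δ : ℝ) :
    (gaussianReal 0 h).map (fun y ↦ y - δ * h) =
      (gaussianReal 0 h).withDensity
        (fun y ↦ ENNReal.ofReal (Real.exp (-δ * y - δ ^ 2 * h / 2))) := by
  have hh' : (h : ℝ) ≠ 0 := by exact_mod_cast hh
  rw [gaussianReal_map_sub_const, gaussianReal_of_var_ne_zero _ hh,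
    gaussianReal_of_var_ne_zero _ hh, ← withDensity_mul _ (measurable_gaussianPDF _ _)
      (by fun_prop)]
  congr 1
  ext y
  simp only [gaussianPDF, Pi.mul_apply]
  rw [← ENNReal.ofReal_mul (gaussianPDFReal_nonneg _ _ _)]
  congr 1
  simp only [gaussianPDFReal]
  rw [mul_assoc (_⁻¹) (Real.exp _), ← Real.exp_add]
  congr 2
  field_simp
  ring

lemma pi_gaussianReal_map_sub_eq_withDensity {h : ℝ≥0} (hh : h ≠ 0) (δ : ℝ) (j : ℕ) :
    (Measure.pi fun _ : Fin j ↦ gaussianReal 0 h).map (fun y i ↦ y i - δ * h) =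
      (Measure.pi fun _ : Fin j ↦ gaussianReal 0 h).withDensity
        (fun y ↦ ENNReal.ofReal (Real.exp (-δ * ∑ i, y i - δ ^ 2 * (j * h) / 2))) := by
  have hprob : IsProbabilityMeasure ((gaussianReal 0 h).map (fun y ↦ y - δ * h)) :=
    Measure.isProbabilityMeasure_map (by fun_prop)
  rw [Measure.pi_map_pi (f := fun _ y ↦ y - δ * (h : ℝ)) (fun _ ↦ by fun_prop)]
  rw [gaussianReal_map_sub_eq_withDensity hh] at hprob ⊢
  rw [pi_withDensity _ (fun _ ↦ by fun_prop)]
  congr 1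
  ext y
  rw [← ENNReal.ofReal_prod_of_nonneg (fun _ _ ↦ (Real.exp_pos _).le), ← Real.exp_sum]
  congr 2
  rw [Finset.sum_sub_distrib, ← Finset.mul_sum]
  simp
  ring

/-- The partial sums of a finite sequence. -/
noncomputable def partialSum {j : ℕ} (y : Fin j → ℝ) (i : ℕ) : ℝ :=
  ∑ l : Fin j, if (l : ℕ) < i then y l else 0

@[fun_prop]
lemma measurable_partialSum {j : ℕ} (i : ℕ) : Measurable fun y : Fin j → ℝ ↦ partialSum y i := by
  unfold partialSum
  refine Finset.measurable_sum _ fun l _ ↦ ?_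
  split_ifs <;> fun_prop

lemma filter_range_lt {i j : ℕ} (hij : i ≤ j) :
    (Finset.range j).filter (· < i) = Finset.range i := by
  ext l; simp; omega

lemma partialSum_eq_sum_range {i j : ℕ} (hij : i ≤ j) (f : ℕ → ℝ) :
    partialSum (fun l : Fin j ↦ f l) i = ∑ l ∈ Finset.range i, f l := by
  rw [partialSum, Fin.sum_univ_eq_sum_range (fun l ↦ if l < i then f l else 0) j,
    ← Finset.sum_filter, filter_range_lt hij]

lemma partialSum_self {j : ℕ} (y : Fin j → ℝ) : partialSum y j = ∑ l, y l := by
  simp [partialSum]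

lemma partialSum_sub_const {i j : ℕ} (hij : i ≤ j) (y : Fin j → ℝ) (c : ℝ) :
    partialSum (fun l ↦ y l - c) i = partialSum y i - i * c := by
  have h1 : partialSum (fun l : Fin j ↦ c) i = i * c := by
    rw [partialSum_eq_sum_range hij (fun _ ↦ c)]; simp
  rw [← h1, partialSum, partialSum, partialSum, ← Finset.sum_sub_distrib]
  refine Finset.sum_congr rfl fun l _ ↦ ?_
  split_ifs <;> simp

/-- The increment sequences for which the first grid hit has index `j`. -/
def hitSet (x k : ℝ) (h : ℝ≥0) (j : ℕ) : Set (Fin j → ℝ) :=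
  {y | 0 < j ∧ x + partialSum y j < k * (j * h) ∧
    ∀ i : ℕ, 0 < i → i < j → k * (i * h) ≤ x + partialSum y i}

lemma measurableSet_hitSet (x k : ℝ) (h : ℝ≥0) (j : ℕ) : MeasurableSet (hitSet x k h j) := by
  simp only [hitSet, measurableSet_setOfPred]
  refine Measurable.and measurable_const (Measurable.and ?_ ?_)
  · exact measurableSet_setOfPred.1 (measurableSet_lt (by fun_prop) (by fun_prop))
  · refine Measurable.forall fun i ↦ Measurable.imp measurable_const (Measurable.imp
      measurable_const ?_)
    exact measurableSet_setOfPred.1 (measurableSet_le (by fun_prop) (by fun_prop))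

/-- Steepening the line by `δ` amounts to subtracting `δ h` from every increment, so a change of
slope becomes a shift of the Gaussian vector. -/
lemma preimage_hitSet (x k₁ k₂ : ℝ) (h : ℝ≥0) (j : ℕ) :
    (fun (y : Fin j → ℝ) l ↦ y l - (k₂ - k₁) * h) ⁻¹' hitSet x k₁ h j = hitSet x k₂ h j := by
  ext y
  simp only [hitSet, Set.mem_preimage, Set.mem_ofPred_eq]
  refine and_congr_right fun _ ↦ and_congr ?_ (forall_congr' fun i ↦ forall_congr' fun _ ↦
    forall_congr' fun hij ↦ ?_)
  · rw [partialSum_sub_const le_rfl]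
    constructor <;> intro h' <;> linarith
  · rw [partialSum_sub_const hij.le]
    constructor <;> intro h' <;> linarith

variable {Ω : Type*} [MeasurableSpace Ω] {P : Measure Ω} {W : ℝ≥0 → Ω → ℝ}

/-- The increments of the path on the grid `0, h, …, j h`. -/
def increments (W : ℝ≥0 → Ω → ℝ) (h : ℝ≥0) (j : ℕ) (ω : Ω) (l : Fin j) : ℝ :=
  W (((l : ℕ) + 1 : ℕ) * h) ω - W ((l : ℕ) * h) ω

lemma aemeasurable_increments (hW : IsPreBrownianReal W P) (h : ℝ≥0) (j : ℕ) :
    AEMeasurable (increments W h j) P :=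
  aemeasurable_pi_lambda _ fun _ ↦ (hW.aemeasurable _).sub (hW.aemeasurable _)

lemma map_increments (hW : IsPreBrownianReal W P) (h : ℝ≥0) (j : ℕ) :
    P.map (increments W h j) = Measure.pi fun _ ↦ gaussianReal 0 h := by
  have := hW.isGaussianProcess.isProbabilityMeasure
  have hind := hW.hasIndepIncrements.nat (t := fun l : ℕ ↦ (l * h : ℝ≥0))
    (fun a b hab ↦ by dsimp only; gcongr)
  have hind' := hind.precomp (g := fun l : Fin j ↦ (l : ℕ)) Fin.val_injective
  have := (iIndepFun_iff_map_fun_eq_pi_map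
    (fun l ↦ (hW.aemeasurable _).sub (hW.aemeasurable _))).1 hind'
  refine this.trans ?_
  congr 1
  ext1 l
  refine (hW.hasLaw_sub _ _).map_eq.trans ?_
  congr 1
  ext
  simp [add_mul]

omit [MeasurableSpace Ω] in
lemma partialSum_increments {ω : Ω} (h0 : W 0 ω = 0) {h : ℝ≥0} {i j : ℕ} (hij : i ≤ j) :
    partialSum (increments W h j ω) i = W (i * h) ω := by
  unfold increments
  rw [partialSum_eq_sum_range hij (fun l ↦ W ((l + 1 : ℕ) * h) ω - W (l * h) ω),
    Finset.sum_range_sub (fun l : ℕ ↦ W (l * h) ω)]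
  simp [h0]

omit [MeasurableSpace Ω] in
lemma increments_mem_hitSet {ω : Ω} (h0 : W 0 ω = 0) (x k : ℝ) (h : ℝ≥0) (j : ℕ) :
    increments W h j ω ∈ hitSet x k h j ↔ IsGridHit x k h (fun t ↦ W t ω) j := by
  simp only [hitSet, IsGridHit, Set.mem_ofPred_eq]
  refine and_congr_right fun _ ↦ and_congr ?_ (forall_congr' fun i ↦ forall_congr' fun _ ↦
    forall_congr' fun hij ↦ ?_)
  · rw [partialSum_increments h0 le_rfl]
  · rw [partialSum_increments h0 hij.le]

/-- Change of drift on a finite grid. -/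
lemma measure_increments_mem_hitSet (hW : IsPreBrownianReal W P) (x k₁ k₂ : ℝ) {h : ℝ≥0}
    (hh : h ≠ 0) (j : ℕ) :
    P {ω | increments W h j ω ∈ hitSet x k₂ h j} =
      ∫⁻ ω, (hitSet x k₁ h j).indicator (fun y ↦ ENNReal.ofReal (Real.exp
        (-(k₂ - k₁) * ∑ i, y i - (k₂ - k₁) ^ 2 * (j * h) / 2))) (increments W h j ω) ∂P := by
  have hm := measurableSet_hitSet x k₁ h j
  have hi := aemeasurable_increments hW h j
  rw [← lintegral_map' (by exact (Measurable.indicator (by fun_prop) hm).aemeasurable) hi,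
    map_increments hW, lintegral_indicator hm, ← withDensity_apply _ hm,
    ← pi_gaussianReal_map_sub_eq_withDensity hh, Measure.map_apply (by fun_prop) hm,
    preimage_hitSet, ← map_increments hW h j,
    Measure.map_apply_of_aemeasurable hi (measurableSet_hitSet _ _ _ _)]
  rfl

end DriftOnGrids

/-! ### The Girsanov formula for hitting times of lines. -/

section Girsanov

variable {Ω : Type*} [MeasurableSpace Ω] {P : Measure Ω} {W : ℝ≥0 → Ω → ℝ}

omit [MeasurableSpace Ω] in
-- `φ` may depend on the whole path; `G` records that at a grid time only the current value matters,
-- so each term is a function of finitely many increments.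
lemma gridValue_eq_tsum_indicator {ω : Ω} (h0 : W 0 ω = 0) (x k : ℝ) {h : ℝ≥0}
    {φ : ℝ≥0 → ℝ≥0∞} {G : ℕ → ℝ → ℝ≥0∞} (hφ : ∀ j : ℕ, φ (j * h) = G j (W (j * h) ω)) :
    gridValue x k h (fun t ↦ W t ω) φ =
      ∑' j, (hitSet x k h j).indicator (fun y ↦ G j (∑ i, y i)) (increments W h j ω) := by
  classical
  unfold gridValue
  congr 1 with j
  simp only [Set.indicator_apply, increments_mem_hitSet h0]
  split_ifs
  · rw [hφ, ← partialSum_self, partialSum_increments h0 le_rfl]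
  · rfl

lemma aemeasurable_gridTerm (hW : IsPreBrownianReal W P) (x k : ℝ) (h : ℝ≥0)
    {G : ℕ → ℝ → ℝ≥0∞} (hG : ∀ j, Measurable (G j)) (j : ℕ) :
    AEMeasurable (fun ω ↦ (hitSet x k h j).indicator (fun y ↦ G j (∑ i, y i))
      (increments W h j ω)) P :=
  (((hG j).comp (by fun_prop)).indicator (measurableSet_hitSet x k h j)).comp_aemeasurable
    (aemeasurable_increments hW h j)

lemma gridValue_ae_eq (hW : IsPreBrownianReal W P) (x k : ℝ) {h : ℝ≥0}
    {φ : Ω → ℝ≥0 → ℝ≥0∞} {G : ℕ → ℝ → ℝ≥0∞}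
    (hφ : ∀ ω, ∀ j : ℕ, φ ω (j * h) = G j (W (j * h) ω)) :
    (fun ω ↦ gridValue x k h (fun t ↦ W t ω) (φ ω)) =ᵐ[P]
      fun ω ↦ ∑' j, (hitSet x k h j).indicator (fun y ↦ G j (∑ i, y i)) (increments W h j ω) := by
  filter_upwards [hW.eval_zero_ae_eq_zero] with ω h0
  exact gridValue_eq_tsum_indicator h0 x k (hφ ω)

lemma aemeasurable_gridValue (hW : IsPreBrownianReal W P) (x k : ℝ) {h : ℝ≥0}
    {φ : Ω → ℝ≥0 → ℝ≥0∞} {G : ℕ → ℝ → ℝ≥0∞} (hG : ∀ j, Measurable (G j))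
    (hφ : ∀ ω, ∀ j : ℕ, φ ω (j * h) = G j (W (j * h) ω)) :
    AEMeasurable (fun ω ↦ gridValue x k h (fun t ↦ W t ω) (φ ω)) P :=
  (AEMeasurable.tsum fun j ↦ aemeasurable_gridTerm hW x k h hG j).congr
    (gridValue_ae_eq hW x k hφ).symm

/-- Change of drift for the discounted first hit on a grid. -/
lemma lintegral_gridValue_eq (hW : IsPreBrownianReal W P) (x k₁ k₂ c : ℝ) {h : ℝ≥0}
    (hh : h ≠ 0) :
    ∫⁻ ω, gridValue x k₂ h (fun t ↦ W t ω) (fun t ↦ ENNReal.ofReal (Real.exp (-c * t))) ∂P =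
      ∫⁻ ω, gridValue x k₁ h (fun t ↦ W t ω) (fun t ↦ ENNReal.ofReal (Real.exp
        (-c * t + (-(k₂ - k₁) * W t ω - (k₂ - k₁) ^ 2 * t / 2)))) ∂P := by
  set δ := k₂ - k₁ with hδ
  have e1 := gridValue_ae_eq hW x k₂ (h := h)
    (φ := fun _ t ↦ ENNReal.ofReal (Real.exp (-c * t)))
    (G := fun j _ ↦ ENNReal.ofReal (Real.exp (-c * (j * h)))) (fun ω j ↦ by simp)
  have e2 := gridValue_ae_eq hW x k₁ (h := h)
    (φ := fun ω t ↦ ENNReal.ofReal (Real.exp (-c * t + (-δ * W t ω - δ ^ 2 * t / 2))))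
    (G := fun j s ↦ ENNReal.ofReal (Real.exp
      (-c * (j * h) + (-δ * s - δ ^ 2 * (j * h) / 2)))) (fun ω j ↦ by simp)
  rw [lintegral_congr_ae e1, lintegral_congr_ae e2,
    lintegral_tsum (aemeasurable_gridTerm hW x k₂ h
      (G := fun j _ ↦ ENNReal.ofReal (Real.exp (-c * (j * h)))) (by fun_prop)),
    lintegral_tsum (aemeasurable_gridTerm hW x k₁ h
      (G := fun j s ↦ ENNReal.ofReal (Real.exp
      (-c * (j * h) + (-δ * s - δ ^ 2 * (j * h) / 2)))) (by fun_prop))]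
  congr 1 with j
  have hpre : NullMeasurableSet {ω | increments W h j ω ∈ hitSet x k₂ h j} P :=
    (aemeasurable_increments hW h j).nullMeasurableSet_preimage (measurableSet_hitSet x k₂ h j)
  calc _ = ∫⁻ ω, {ω | increments W h j ω ∈ hitSet x k₂ h j}.indicator
          (fun _ ↦ ENNReal.ofReal (Real.exp (-c * (j * h)))) ω ∂P := rfl
    _ = ENNReal.ofReal (Real.exp (-c * (j * h))) *
        P {ω | increments W h j ω ∈ hitSet x k₂ h j} := lintegral_indicator_const₀ hpre _
    _ = _ := by
      rw [measure_increments_mem_hitSet hW x k₁ k₂ hh, ← lintegral_const_mul' _ _ (by simp)]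
      refine lintegral_congr fun ω ↦ ?_
      by_cases hm : increments W h j ω ∈ hitSet x k₁ h j
      · rw [Set.indicator_of_mem hm, Set.indicator_of_mem hm,
          ← ENNReal.ofReal_mul (Real.exp_pos _).le, ← Real.exp_add]
      · rw [Set.indicator_of_notMem hm, Set.indicator_of_notMem hm, mul_zero]

/-- The grid identity passes to the limit by dominated convergence for slope `k₂`. For slope `k₁`
the exponential weight need not be bounded, so Fatou gives only an inequality. -/
lemma lintegral_discount_hit_le (hW : IsBrownianReal W P) {x : ℝ} (hx : 0 ≤ x) (k₁ k₂ : ℝ)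
    {c : ℝ} (hc : 0 ≤ c) :
    ENNReal.ofReal (Real.exp ((k₂ - k₁) * x)) *
        ∫⁻ ω, discount (c + ((k₂ - k₁) * k₁ + (k₂ - k₁) ^ 2 / 2)) (hit x k₁ (fun t ↦ W t ω)) ∂P ≤
      ∫⁻ ω, discount c (hit x k₂ (fun t ↦ W t ω)) ∂P := by
  have := hW.isGaussianProcess.isProbabilityMeasure
  set δ := k₂ - k₁ with hδ
  rw [← lintegral_const_mul' _ _ (by simp)]
  have hlim : Tendsto (fun n ↦ ∫⁻ ω, gridValue x k₂ (mesh n) (fun t ↦ W t ω)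
      (fun t ↦ ENNReal.ofReal (Real.exp (-c * t))) ∂P) atTop
      (𝓝 (∫⁻ ω, discount c (hit x k₂ (fun t ↦ W t ω)) ∂P)) := by
    refine tendsto_lintegral_of_dominated_convergence' (fun _ ↦ 1) (fun n ↦ ?_) (fun n ↦ ?_)
      (by simp) ?_
    · exact aemeasurable_gridValue hW.toIsPreBrownianReal x k₂
        (G := fun j _ ↦ ENNReal.ofReal (Real.exp (-c * (j * mesh n)))) (by fun_prop)
        (fun ω j ↦ by simp)
    · refine ae_of_all _ fun ω ↦ gridValue_le fun t ↦ ?_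
      rw [ENNReal.ofReal_le_one, Real.exp_le_one_iff]
      have : 0 ≤ c * t := by positivity
      linarith
    · filter_upwards [hW.cont] with ω hω
      exact tendsto_gridValue hω (ENNReal.continuous_ofReal.comp (by fun_prop))
  simp_rw [lintegral_gridValue_eq hW.toIsPreBrownianReal x k₁ k₂ c (mesh_pos _).ne'] at hlim
  rw [← hlim.liminf_eq]
  refine le_trans (lintegral_mono_ae ?_) (lintegral_liminf_le' fun n ↦ ?_)
  · filter_upwards [hW.cont, hW.eval_zero_ae_eq_zero] with ω hω h0
    have h1 := tendsto_gridValue hω (x := x) (k := k₁) (φ := fun t ↦ ENNReal.ofReal (Real.exp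
        (-c * t + (-δ * W t ω - δ ^ 2 * t / 2)))) (ENNReal.continuous_ofReal.comp (by fun_prop))
    rw [h1.liminf_eq, discount]
    split_ifs with hT
    · simp
    · rw [← ENNReal.ofReal_mul (Real.exp_pos _).le, ← Real.exp_add]
      refine ENNReal.ofReal_le_ofReal (Real.exp_le_exp.2 (le_of_eq ?_))
      -- On the line `W_T = k₁ T - x`, which turns the Girsanov weight into a function of `T` alone.
      linear_combination δ * add_apply_hit hω hx h0 hT
  · exact aemeasurable_gridValue hW.toIsPreBrownianReal x k₁ (G := fun j s ↦ ENNReal.ofReal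
      (Real.exp (-c * (j * mesh n) + (-δ * s - δ ^ 2 * (j * mesh n) / 2)))) (by fun_prop)
      (fun ω j ↦ by simp [hδ])

/-- The Cameron–Martin–Girsanov formula for the Laplace transform of the hitting time of a line:
changing the slope from `k₁` to `k₂ ≥ k₁ ≥ 0` is an exponential change of measure. -/
lemma lintegral_discount_hit_eq (hW : IsBrownianReal W P) {x : ℝ} (hx : 0 ≤ x) {k₁ k₂ : ℝ}
    (hk₁ : 0 ≤ k₁) (hk : k₁ ≤ k₂) {c : ℝ} (hc : 0 ≤ c) :
    ∫⁻ ω, discount c (hit x k₂ (fun t ↦ W t ω)) ∂P =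
      ENNReal.ofReal (Real.exp ((k₂ - k₁) * x)) *
        ∫⁻ ω, discount (c + ((k₂ - k₁) * k₁ + (k₂ - k₁) ^ 2 / 2))
          (hit x k₁ (fun t ↦ W t ω)) ∂P := by
  refine le_antisymm ?_ (lintegral_discount_hit_le hW hx k₁ k₂ hc)
  have hα : 0 ≤ c + ((k₂ - k₁) * k₁ + (k₂ - k₁) ^ 2 / 2) := by
    have := mul_nonneg (sub_nonneg.2 hk) hk₁
    positivity
  -- The reverse inequality is the same lemma with the slopes exchanged: the two discount shifts
  -- cancel, and so do the two factors in `x`.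
  have h1 := lintegral_discount_hit_le hW hx k₂ k₁ hα
  rw [show c + ((k₂ - k₁) * k₁ + (k₂ - k₁) ^ 2 / 2) + ((k₁ - k₂) * k₂ + (k₁ - k₂) ^ 2 / 2) = c
    by ring] at h1
  have h2 := mul_le_mul_right h1 (ENNReal.ofReal (Real.exp ((k₂ - k₁) * x)))
  rwa [← mul_assoc, ← ENNReal.ofReal_mul (Real.exp_pos _).le, ← Real.exp_add,
    show (k₂ - k₁) * x + (k₁ - k₂) * x = 0 by ring, Real.exp_zero, ENNReal.ofReal_one,
    one_mul] at h2

end Girsanov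

/-! ### Uniqueness of Laplace transforms on the half-line. -/

section LaplaceUniqueness

/-- A compactly supported distribution is determined by its moments. -/
lemma ext_of_moments {μ ν : Measure ℝ} [IsProbabilityMeasure μ] [IsProbabilityMeasure ν] {a b : ℝ}
    (hμ : ∀ᵐ x ∂μ, x ∈ Set.Icc a b) (hν : ∀ᵐ x ∂ν, x ∈ Set.Icc a b)
    (h : ∀ n : ℕ, ∫ x, x ^ n ∂μ = ∫ x, x ^ n ∂ν) : μ = ν := by
  have hμ' : integrableExpSet id μ = Set.univ :=
    Set.eq_univ_of_forall fun t ↦ integrable_exp_mul_of_mem_Icc aemeasurable_id hμ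
  have hν' : integrableExpSet id ν = Set.univ :=
    Set.eq_univ_of_forall fun t ↦ integrable_exp_mul_of_mem_Icc aemeasurable_id hν
  have h1 := hasFPowerSeriesAt_mgf (X := id) (μ := μ) (v := 0) (by simp [hμ'])
  have h2 := hasFPowerSeriesAt_mgf (X := id) (μ := ν) (v := 0) (by simp [hν'])
  -- Moments are the Taylor data at `0` of the moment generating function, which is analytic on the
  -- whole line here.
  have hcoef : (fun n : ℕ ↦ (μ[fun x ↦ id x ^ n * Real.exp (0 * id x)] : ℝ) / n.factorial) =
      fun n : ℕ ↦ (ν[fun x ↦ id x ^ n * Real.exp (0 * id x)] : ℝ) / n.factorial := by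
    ext n
    simp [h n]
  rw [hcoef] at h1
  have hev : mgf id μ =ᶠ[𝓝 0] mgf id ν := by
    filter_upwards [h1.eventually_hasSum, h2.eventually_hasSum] with x hx hx'
    simpa using hx.unique hx'
  have hm : mgf id μ = mgf id ν := by
    have a1 : AnalyticOnNhd ℝ (mgf id μ) Set.univ := by
      simpa [hμ'] using analyticOnNhd_mgf (X := id) (μ := μ)
    have a2 : AnalyticOnNhd ℝ (mgf id ν) Set.univ := by
      simpa [hν'] using analyticOnNhd_mgf (X := id) (μ := ν)
    exact a1.eq_of_eventuallyEq a2 hev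
  refine Measure.ext_of_complexMGF_id_eq ?_
  ext z
  exact eqOn_complexMGF_of_mgf hm (by simp [hμ'])

lemma exp_neg_mem_Icc {x : ℝ} (hx : 0 ≤ x) : Real.exp (-x) ∈ Set.Icc (0 : ℝ) 1 :=
  ⟨(Real.exp_pos _).le, by simpa using hx⟩

lemma integral_exp_neg_mem_Ioc {μ : Measure ℝ} [IsProbabilityMeasure μ] (h0 : ∀ᵐ x ∂μ, 0 ≤ x)
    {s : ℝ} (hs : 0 ≤ s) : ∫ x, Real.exp (-s * x) ∂μ ∈ Set.Ioc (0 : ℝ) 1 := by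
  have hb : ∀ᵐ x ∂μ, Real.exp (-s * x) ∈ Set.Icc (0 : ℝ) 1 := by
    filter_upwards [h0] with x hx
    simpa using exp_neg_mem_Icc (mul_nonneg hs hx)
  have hint : Integrable (fun x ↦ Real.exp (-s * x)) μ :=
    Integrable.of_mem_Icc 0 1 (by fun_prop) hb
  refine ⟨integral_exp_pos hint, ?_⟩
  calc _ ≤ ∫ _, (1 : ℝ) ∂μ := integral_mono_ae hint (integrable_const _) (hb.mono fun x hx ↦ hx.2)
    _ = 1 := by simp

/-- A distribution whose Laplace transform is that of a non-negative random variable is supported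
by the half-line. -/
lemma ae_nonneg_of_laplace_le_one {ν : Measure ℝ} [IsProbabilityMeasure ν]
    (h : ∀ n : ℕ, ∫ x, Real.exp (-n * x) ∂ν ∈ Set.Ioc (0 : ℝ) 1) : ∀ᵐ x ∂ν, 0 ≤ x := by
  have hzero : ∀ m : ℕ, ν {x | x ≤ -(1 / ((m : ℝ) + 1))} = 0 := by
    intro m
    have hpos : (0 : ℝ) < 1 / ((m : ℝ) + 1) := by positivity
    -- Chernoff bound: mass at or below `-ε` would make the transform grow like `exp (n ε)`.
    have hle : ∀ n : ℕ, ν.real {x | x ≤ -(1 / ((m : ℝ) + 1))} ≤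
        Real.exp (-(1 / ((m : ℝ) + 1))) ^ n := by
      intro n
      have hint : Integrable (fun x ↦ Real.exp (-n * id x)) ν := by
        -- A non-integrable function has integral `0` by convention, so positivity of the transform
        -- gives integrability.
        by_contra hc
        have := (h n).1
        exact this.ne' (integral_undef hc)
      refine (measure_le_le_exp_mul_mgf (X := id) (t := -n) _ (by simp) hint).trans ?_
      rw [← Real.exp_nat_mul]
      have h1 : mgf id ν (-n) ≤ 1 := (h n).2
      have h2 : - -(n : ℝ) * -(1 / ((m : ℝ) + 1)) = n * -(1 / ((m : ℝ) + 1)) := by ring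
      rw [h2]
      exact mul_le_of_le_one_right (Real.exp_pos _).le h1
    have hlim := tendsto_pow_atTop_nhds_zero_of_lt_one (r := Real.exp (-(1 / ((m : ℝ) + 1))))
      (Real.exp_pos _).le (by rw [Real.exp_lt_one_iff]; linarith)
    have := ge_of_tendsto' hlim hle
    exact (measureReal_eq_zero_iff).1 (le_antisymm this measureReal_nonneg)
  have : ∀ᵐ x ∂ν, ∀ m : ℕ, ¬ x ≤ -(1 / ((m : ℝ) + 1)) := by
    rw [ae_all_iff]
    intro m
    rw [ae_iff]
    simpa using hzero m
  filter_upwards [this] with x hx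
  by_contra! hneg
  obtain ⟨m, hm⟩ := exists_nat_one_div_lt (neg_pos.2 hneg)
  exact hx m (by linarith)

/-- A distribution on the half-line is determined among all distributions on the line by its
Laplace transform at the natural numbers. -/
lemma ext_of_laplace {μ ν : Measure ℝ} [IsProbabilityMeasure μ] [IsProbabilityMeasure ν]
    (hμ : ∀ᵐ x ∂μ, 0 ≤ x)
    (h : ∀ n : ℕ, ∫ x, Real.exp (-n * x) ∂ν = ∫ x, Real.exp (-n * x) ∂μ) : ν = μ := by
  have hν : ∀ᵐ x ∂ν, 0 ≤ x := ae_nonneg_of_laplace_le_one fun n ↦ by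
    rw [h n]
    exact integral_exp_neg_mem_Ioc hμ n.cast_nonneg
  have hU : Measurable fun x : ℝ ↦ Real.exp (-x) := by fun_prop
  -- Under `x ↦ exp (-x)` the laws move to `[0, 1]`, and the transform at `n` becomes the `n`-th
  -- moment.
  have hmap : ν.map (fun x ↦ Real.exp (-x)) = μ.map (fun x ↦ Real.exp (-x)) := by
    have := Measure.isProbabilityMeasure_map (μ := μ) hU.aemeasurable
    have := Measure.isProbabilityMeasure_map (μ := ν) hU.aemeasurable
    refine ext_of_moments (a := 0) (b := 1) ?_ ?_ fun n ↦ ?_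
    · refine (ae_map_iff (p := (· ∈ Set.Icc (0 : ℝ) 1)) hU.aemeasurable measurableSet_Icc).2 ?_
      exact hν.mono fun x hx ↦ exp_neg_mem_Icc hx
    · refine (ae_map_iff (p := (· ∈ Set.Icc (0 : ℝ) 1)) hU.aemeasurable measurableSet_Icc).2 ?_
      exact hμ.mono fun x hx ↦ exp_neg_mem_Icc hx
    · rw [integral_map hU.aemeasurable (by fun_prop), integral_map hU.aemeasurable (by fun_prop)]
      have hpow : ∀ x : ℝ, Real.exp (-x) ^ n = Real.exp (-n * x) := fun x ↦ by
        rw [← Real.exp_nat_mul]; congr 1; ring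
      simp_rw [hpow]
      exact h n
  have hinv : (fun y : ℝ ↦ -Real.log y) ∘ (fun x : ℝ ↦ Real.exp (-x)) = id := by
    ext x; simp
  have hlog : Measurable fun y : ℝ ↦ -Real.log y := by fun_prop
  calc ν = (ν.map (fun x ↦ Real.exp (-x))).map (fun y ↦ -Real.log y) := by
        rw [Measure.map_map hlog hU, hinv, Measure.map_id]
    _ = μ := by rw [hmap, Measure.map_map hlog hU, hinv, Measure.map_id]

end LaplaceUniqueness

/-! ### Reduction to rational times: measurability, conditioning on the start, almost sure hitting.
-/

section RationalTimes

/-- The first rational time at which the path `x + w` is below the line of slope `k`. -/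
noncomputable def ratHit (k : ℝ) (p : ℝ × (ℚ≥0 → ℝ)) : ℝ≥0∞ :=
  ⨅ q : ℚ≥0, if 0 < q ∧ p.1 + p.2 q < k * (q : ℝ) then ((q : ℝ≥0) : ℝ≥0∞) else ∞

lemma measurable_ratHit (k : ℝ) : Measurable (ratHit k) := by
  unfold ratHit
  refine Measurable.iInf fun q ↦ Measurable.ite ?_ measurable_const measurable_const
  by_cases hq : 0 < q
  · simp only [hq, true_and]
    exact measurableSet_lt (by fun_prop) (by fun_prop)
  · simp [hq]

/-- The restriction of a path to the rational times. -/
def ratPath (w : ℝ≥0 → ℝ) (q : ℚ≥0) : ℝ := w q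

lemma hit_eq_ratHit {w : ℝ≥0 → ℝ} (hw : Continuous w) (x k : ℝ) :
    hit x k w = ratHit k (x, ratPath w) := by
  refine le_antisymm (le_iInf fun q ↦ ?_) (le_of_forall_gt fun r hr ↦ ?_)
  · split_ifs with hq
    · exact hit_le (by exact_mod_cast hq.1) hq.2
    · exact le_top
  · obtain ⟨r', hr', hrr'⟩ := ENNReal.lt_iff_exists_nnreal_btwn.1 hr
    obtain ⟨n, j, hj, hjr⟩ := (eventually_exists_isGridHit hw hr').exists
    -- The grid points `j / (n + 1)` are rational, so grid hits are hits at rational times.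
    have hcast : ((j / (n + 1) : ℚ≥0) : ℝ≥0) = j * mesh n := by
      simp [mesh, div_eq_mul_inv]
    have hcast' : ((j / (n + 1) : ℚ≥0) : ℝ) = j * mesh n := by
      rw [← NNReal.coe_natCast, ← NNReal.coe_mul, ← hcast]; simp
    refine lt_of_le_of_lt (iInf_le _ (j / (n + 1) : ℚ≥0)) (lt_trans ?_ hrr')
    rw [if_pos, hcast]
    · exact_mod_cast hjr
    · refine ⟨by have := hj.1; positivity, ?_⟩
      simp only [ratPath]
      rw [hcast, hcast']
      exact hj.2.1

variable {Ω Ω' : Type*} [MeasurableSpace Ω] [MeasurableSpace Ω'] {P : Measure Ω} {P' : Measure Ω'}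
  {W : ℝ≥0 → Ω → ℝ} {W' : ℝ≥0 → Ω' → ℝ} {ξ : Ω → ℝ}

lemma aemeasurable_ratPath (hW : IsPreBrownianReal W P) :
    AEMeasurable (fun ω ↦ ratPath (fun t ↦ W t ω)) P :=
  aemeasurable_pi_lambda _ fun q ↦ hW.aemeasurable q

lemma map_restrict_ratPath (hW : IsPreBrownianReal W P) (I : Finset ℚ≥0) :
    P.map (fun ω ↦ I.restrict (ratPath (fun t ↦ W t ω))) =
      open Classical in
      (BrownianReal.projectiveFamily (I.image (fun q : ℚ≥0 ↦ (q : ℝ≥0)))).map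
        (fun z (i : I) ↦ z ⟨i.1, Finset.mem_image_of_mem _ i.2⟩) := by
  rw [← (hW.hasLaw _).map_eq, AEMeasurable.map_map_of_aemeasurable
    (measurable_pi_lambda _ fun i ↦ measurable_pi_apply _).aemeasurable (hW.hasLaw _).aemeasurable]
  rfl

/-- All Brownian motions have the same law at rational times. -/
lemma map_ratPath_eq (hW : IsPreBrownianReal W P) (hW' : IsPreBrownianReal W' P') :
    P.map (fun ω ↦ ratPath (fun t ↦ W t ω)) = P'.map (fun ω ↦ ratPath (fun t ↦ W' t ω)) := by
  have := hW.isGaussianProcess.isProbabilityMeasure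
  have h1 := isProjectiveLimit_map (X := fun (q : ℚ≥0) ω ↦ W q ω) (aemeasurable_ratPath hW)
  have h2 := isProjectiveLimit_map (X := fun (q : ℚ≥0) ω ↦ W' q ω) (aemeasurable_ratPath hW')
  have heq : (fun I : Finset ℚ≥0 ↦ P.map (fun ω ↦ I.restrict (fun q : ℚ≥0 ↦ W q ω))) =
      fun I : Finset ℚ≥0 ↦ P'.map (fun ω ↦ I.restrict (fun q : ℚ≥0 ↦ W' q ω)) :=
    funext fun I ↦ (map_restrict_ratPath hW I).trans (map_restrict_ratPath hW' I).symm
  rw [← heq] at h2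
  exact h1.unique h2

lemma firstHittingTime_ae_eq (hW : IsBrownianReal W P) (ξ : Ω → ℝ) (k : ℝ) :
    firstHittingTime W ξ k =ᵐ[P] fun ω ↦ ratHit k (ξ ω, ratPath (fun t ↦ W t ω)) := by
  filter_upwards [hW.cont] with ω hω
  rw [firstHittingTime_eq_hit, hit_eq_ratHit hω]

lemma aemeasurable_firstHittingTime (hW : IsBrownianReal W P) (hξ : AEMeasurable ξ P) (k : ℝ) :
    AEMeasurable (firstHittingTime W ξ k) P :=
  ((measurable_ratHit k).comp_aemeasurable
    (hξ.prodMk (aemeasurable_ratPath hW.toIsPreBrownianReal))).congr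
      (firstHittingTime_ae_eq hW ξ k).symm

lemma lintegral_comp_hit (hW : IsBrownianReal W P) (x k : ℝ) {f : ℝ≥0∞ → ℝ≥0∞}
    (hf : Measurable f) :
    ∫⁻ ω, f (hit x k (fun t ↦ W t ω)) ∂P =
      ∫⁻ w, f (ratHit k (x, w)) ∂P.map (fun ω ↦ ratPath (fun t ↦ W t ω)) := by
  have hm := hf.comp ((measurable_ratHit k).comp (measurable_prodMk_left (x := x)))
  rw [lintegral_map' (f := fun w ↦ f (ratHit k (x, w))) hm.aemeasurable
    (aemeasurable_ratPath hW.toIsPreBrownianReal)]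
  refine lintegral_congr_ae ?_
  filter_upwards [hW.cont] with ω hω
  rw [hit_eq_ratHit hω]

/-- Conditioning on an independent starting point; the hitting times of the deterministic starting
points may be taken for any other Brownian motion. -/
lemma lintegral_comp_firstHittingTime (hW : IsBrownianReal W P) (hξ : AEMeasurable ξ P)
    (hind : IndepFun ξ (fun ω t ↦ W t ω) P) (hW' : IsBrownianReal W' P') (k : ℝ)
    {f : ℝ≥0∞ → ℝ≥0∞} (hf : Measurable f) :
    ∫⁻ ω, f (firstHittingTime W ξ k ω) ∂P =
      ∫⁻ x, ∫⁻ ω, f (hit x k (fun t ↦ W' t ω)) ∂P' ∂P.map ξ := by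
  have := hW.isGaussianProcess.isProbabilityMeasure
  have hpath := aemeasurable_ratPath hW.toIsPreBrownianReal
  have := Measure.isProbabilityMeasure_map hpath
  have := Measure.isProbabilityMeasure_map hξ
  simp_rw [lintegral_comp_hit hW' _ k hf]
  rw [← map_ratPath_eq hW.toIsPreBrownianReal hW'.toIsPreBrownianReal]
  have hind' : IndepFun ξ (fun ω ↦ ratPath (fun t ↦ W t ω)) P :=
    hind.comp (φ := id) (ψ := ratPath) measurable_id
      (measurable_pi_lambda _ fun q ↦ measurable_pi_apply _)
  have hlaw := (indepFun_iff_map_prod_eq_prod_map_map hξ hpath).1 hind'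
  have hm : Measurable fun p ↦ f (ratHit k p) := hf.comp (measurable_ratHit k)
  calc ∫⁻ ω, f (firstHittingTime W ξ k ω) ∂P
      = ∫⁻ ω, f (ratHit k (ξ ω, ratPath (fun t ↦ W t ω))) ∂P :=
        lintegral_congr_ae ((firstHittingTime_ae_eq hW ξ k).fun_comp f)
    _ = ∫⁻ p, f (ratHit k p) ∂P.map (fun ω ↦ (ξ ω, ratPath (fun t ↦ W t ω))) :=
        (lintegral_map' hm.aemeasurable (hξ.prodMk hpath)).symm
    _ = _ := by rw [hlaw, lintegral_prod _ hm.aemeasurable]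

/-- A Brownian motion falls below any line of positive slope. -/
lemma lintegral_discount_zero_hit (hW : IsBrownianReal W P) (x : ℝ) {k : ℝ} (hk : 0 < k) :
    ∫⁻ ω, discount 0 (hit x k (fun t ↦ W t ω)) ∂P = 1 := by
  have := hW.isGaussianProcess.isProbabilityMeasure
  have hfin : P {ω | hit x k (fun t ↦ W t ω) = ∞} = 0 := by
    have hle : ∀ᶠ n : ℕ in atTop, P {ω | hit x k (fun t ↦ W t ω) = ∞} ≤
        ENNReal.ofReal (n / (k * n - x) ^ 2) := by
      have hlim : Tendsto (fun n : ℕ ↦ k * n) atTop atTop :=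
        tendsto_natCast_atTop_atTop.const_mul_atTop hk
      filter_upwards [hlim.eventually_gt_atTop x, eventually_gt_atTop 0] with n hn hn0
      -- No hit by time `n` forces `|W_n| ≥ k n - x`; Chebyshev with variance `n` bounds this by `n
      -- / (k n - x)²`.
      have hlaw := hW.hasLaw_eval n
      have hcheb := meas_ge_le_variance_div_sq (X := W n) (μ := P) hlaw.hasGaussianLaw.memLp_two
        (c := k * n - x) (by linarith)
      rw [hlaw.variance_eq, variance_id_gaussianReal, hW.integral_eval] at hcheb
      refine le_trans (measure_mono fun ω hω ↦ ?_) (by simpa using hcheb)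
      by_contra hc
      simp only [Set.mem_ofPred_eq, not_le] at hc
      have h1 := hit_le (x := x) (k := k) (w := fun t ↦ W t ω) (t := n) (by exact_mod_cast hn0)
        (by have := le_abs_self (W n ω); push_cast; linarith)
      rw [Set.mem_ofPred_eq] at hω
      simp [hω] at h1
    have hlim : Tendsto (fun n : ℕ ↦ ENNReal.ofReal (n / (k * n - x) ^ 2)) atTop (𝓝 0) := by
      have h0 : Tendsto (fun n : ℕ ↦ (n : ℝ)⁻¹) atTop (𝓝 0) := tendsto_inv_atTop_nhds_zero_nat
      have h1 : Tendsto (fun n : ℕ ↦ (n : ℝ)⁻¹ / (k - x * (n : ℝ)⁻¹) ^ 2) atTop (𝓝 0) := by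
        have := h0.div (((h0.const_mul x).const_sub k).pow 2) (by simp [hk.ne'])
        simpa [Pi.div_def] using this
      rw [← ENNReal.ofReal_zero]
      refine (ENNReal.continuous_ofReal.tendsto 0).comp (h1.congr' ?_)
      filter_upwards [eventually_gt_atTop 0] with n hn
      have : (n : ℝ) ≠ 0 := by positivity
      rw [show k - x * (n : ℝ)⁻¹ = (k * n - x) / n by field_simp, div_pow]
      field_simp
    exact le_antisymm (ge_of_tendsto hlim hle) zero_le
  rw [← measure_univ (μ := P), ← lintegral_one]
  refine lintegral_congr_ae ?_
  have : ∀ᵐ ω ∂P, hit x k (fun t ↦ W t ω) ≠ ∞ := by simpa [ae_iff] using hfin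
  filter_upwards [this] with ω hω
  simp [discount, hω]

end RationalTimes

/-! ### Esscher families as exponentially tilted laws. -/

section Esscher

variable {Ω Ω' Ω₁ : Type*} [MeasurableSpace Ω] [MeasurableSpace Ω'] [MeasurableSpace Ω₁]
  {P : Measure Ω} {P' : Measure Ω'} {P₁ : Measure Ω₁}

lemma laplace_eq_integral_map {η : Ω → ℝ} (hη : AEMeasurable η P) (s : ℝ) :
    laplace η P s = ∫ x, Real.exp (-s * x) ∂P.map η := by
  rw [integral_map hη (by fun_prop)]
  rfl

lemma integral_exp_tilted (μ : Measure ℝ) (a s : ℝ) :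
    ∫ x, Real.exp (-s * x) ∂μ.tilted (fun x ↦ -a * x) =
      (∫ x, Real.exp (-(a + s) * x) ∂μ) / ∫ x, Real.exp (-a * x) ∂μ := by
  rw [integral_tilted, ← integral_div]
  refine integral_congr_ae (ae_of_all _ fun x ↦ ?_)
  simp only [smul_eq_mul]
  rw [div_mul_eq_mul_div, ← Real.exp_add]
  congr 2
  ring

lemma integrable_exp_of_nonneg {η : Ω → ℝ} [IsProbabilityMeasure P] (hη : AEMeasurable η P)
    (h0 : ∀ᵐ ω ∂P, 0 ≤ η ω) {a : ℝ} (ha : 0 ≤ a) :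
    Integrable (fun ω ↦ Real.exp (-a * η ω)) P := by
  refine Integrable.of_mem_Icc 0 1 (by fun_prop) ?_
  filter_upwards [h0] with ω hω
  simpa using exp_neg_mem_Icc (mul_nonneg ha hω)

lemma laplace_pos {η : Ω → ℝ} [IsProbabilityMeasure P] (hη : AEMeasurable η P)
    (h0 : ∀ᵐ ω ∂P, 0 ≤ η ω) {a : ℝ} (ha : 0 ≤ a) : 0 < laplace η P a :=
  integral_exp_pos (integrable_exp_of_nonneg hη h0 ha)

lemma ae_nonneg_map {η : Ω → ℝ} (hη : AEMeasurable η P) :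
    (∀ᵐ x ∂P.map η, 0 ≤ x) ↔ ∀ᵐ ω ∂P, 0 ≤ η ω :=
  ae_map_iff (p := fun x ↦ (0 : ℝ) ≤ x) hη measurableSet_Ici

lemma isProbabilityMeasure_tilted_map {η : Ω → ℝ} [IsProbabilityMeasure P] (hη : AEMeasurable η P)
    (h0 : ∀ᵐ ω ∂P, 0 ≤ η ω) {a : ℝ} (ha : 0 ≤ a) :
    IsProbabilityMeasure ((P.map η).tilted fun x ↦ -a * x) := by
  have := Measure.isProbabilityMeasure_map hη
  exact isProbabilityMeasure_tilted
    (integrable_exp_of_nonneg (η := id) aemeasurable_id ((ae_nonneg_map hη).2 h0) ha)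

/-- The members of the Esscher family have the exponentially tilted distributions. -/
lemma IsEsscher.map_eq_tilted {η : Ω → ℝ} {ηa : Ω' → ℝ} {a : ℝ} [IsProbabilityMeasure P]
    (hη : AEMeasurable η P) (h0 : ∀ᵐ ω ∂P, 0 ≤ η ω) (h : IsEsscher a P η P' ηa) :
    P'.map ηa = (P.map η).tilted fun x ↦ -a * x := by
  have := h.isProbabilityMeasure
  have := Measure.isProbabilityMeasure_map hη
  have := Measure.isProbabilityMeasure_map h.aemeasurable
  have := isProbabilityMeasure_tilted_map hη h0 h.param_pos.le
  -- Only the tilted law has to be known to live on the half-line; non-negativity of `ηa` is a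
  -- consequence.
  refine ext_of_laplace ?_ fun n ↦ ?_
  · exact (tilted_absolutelyContinuous _ _).ae_le ((ae_nonneg_map hη).2 h0)
  · rw [← laplace_eq_integral_map h.aemeasurable, h.laplace_eq n n.cast_nonneg,
      integral_exp_tilted, laplace_eq_integral_map hη, laplace_eq_integral_map hη]

lemma IsEsscher.ae_nonneg {η : Ω → ℝ} {ηa : Ω' → ℝ} {a : ℝ} [IsProbabilityMeasure P]
    (hη : AEMeasurable η P) (h0 : ∀ᵐ ω ∂P, 0 ≤ η ω) (h : IsEsscher a P η P' ηa) :
    ∀ᵐ ω ∂P', 0 ≤ ηa ω := by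
  rw [← ae_nonneg_map h.aemeasurable, h.map_eq_tilted hη h0]
  exact (tilted_absolutelyContinuous _ _).ae_le ((ae_nonneg_map hη).2 h0)

lemma lintegral_discount_eq_laplace [IsProbabilityMeasure P] {T : Ω → ℝ≥0∞}
    (hT : AEMeasurable T P) (hfin : ∀ᵐ ω ∂P, T ω ≠ ∞) {c : ℝ} (hc : 0 ≤ c) :
    ∫⁻ ω, discount c (T ω) ∂P = ENNReal.ofReal (laplace (fun ω ↦ (T ω).toReal) P c) := by
  rw [laplace, ofReal_integral_eq_lintegral_ofReal
    (integrable_exp_of_nonneg hT.ennreal_toReal (by simp) hc)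
    (ae_of_all _ fun ω ↦ (Real.exp_pos _).le)]
  refine lintegral_congr_ae ?_
  filter_upwards [hfin] with ω hω
  rw [discount, if_neg hω]
  rfl

/-- `discount 0` is the indicator of finiteness. -/
lemma ae_ne_top_of_lintegral_discount [IsProbabilityMeasure P] {T : Ω → ℝ≥0∞}
    (h : ∫⁻ ω, discount 0 (T ω) ∂P = 1) : ∀ᵐ ω ∂P, T ω ≠ ∞ := by
  have := ae_eq_of_ae_le_of_lintegral_le (μ := P) (f := fun ω ↦ discount 0 (T ω))
    (g := fun _ ↦ 1) (ae_of_all _ fun ω ↦ discount_le_one le_rfl _) (by simp [h])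
    aemeasurable_const (by simp [h])
  filter_upwards [this] with ω hω hω'
  simp [discount, hω'] at hω

end Esscher

/-! ### Transformed solutions and their construction. -/

section Solution

variable {Ω Ω₀ Ω' : Type*} [MeasurableSpace Ω] [MeasurableSpace Ω₀] [MeasurableSpace Ω']
  {P : Measure Ω} {P₀ : Measure Ω₀} {P' : Measure Ω'} {W : ℝ≥0 → Ω → ℝ} {W' : ℝ≥0 → Ω' → ℝ}
  {ξ : Ω → ℝ} {τ : Ω₀ → ℝ} {ξ' : Ω' → ℝ} {k₀ k : ℝ}

lemma IsSolution.map_firstHittingTime (h : IsSolution P W ξ P₀ τ k₀) :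
    P.map (firstHittingTime W ξ k₀) = P₀.map (fun ω ↦ ENNReal.ofReal (τ ω)) := by
  have := h.isProbabilityMeasure
  have := h.isProbabilityMeasure_target
  have hT := aemeasurable_firstHittingTime h.brownian h.aemeasurable_start k₀
  have hτ : AEMeasurable (fun ω ↦ ENNReal.ofReal (τ ω)) P₀ := h.aemeasurable_target.ennreal_ofReal
  have := Measure.isProbabilityMeasure_map hT
  have := Measure.isProbabilityMeasure_map hτ
  refine Measure.ext_of_Iic _ _ fun t ↦ ?_
  induction t with
  -- `cdf_eq` concerns finite times only; at `∞` both sides are total masses.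
  | top => simp
  | coe t =>
    rw [Measure.map_apply_of_aemeasurable hT measurableSet_Iic,
      Measure.map_apply_of_aemeasurable hτ measurableSet_Iic]
    refine (h.cdf_eq t).trans (congrArg P₀ ?_)
    ext ω
    simp

lemma IsSolution.lintegral_discount (h : IsSolution P W ξ P₀ τ k₀) {c : ℝ} (hc : 0 ≤ c) :
    ∫⁻ ω, discount c (firstHittingTime W ξ k₀ ω) ∂P = ENNReal.ofReal (laplace τ P₀ c) := by
  have := h.isProbabilityMeasure_target
  have hτ : AEMeasurable (fun ω ↦ ENNReal.ofReal (τ ω)) P₀ := h.aemeasurable_target.ennreal_ofReal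
  rw [← lintegral_map' (measurable_discount c).aemeasurable
    (aemeasurable_firstHittingTime h.brownian h.aemeasurable_start k₀), h.map_firstHittingTime,
    lintegral_map' (measurable_discount c).aemeasurable hτ,
    lintegral_discount_eq_laplace hτ (by simp) hc]
  congr 1
  refine integral_congr_ae ?_
  filter_upwards [h.target_nonneg] with ω hω
  rw [ENNReal.toReal_ofReal hω]

/-- The Laplace transform of the hitting time after a simultaneous Esscher transform of the starting
point and increase of the slope. -/
lemma IsSolution.lintegral_discount_of_isEsscher (h : IsSolution P W ξ P₀ τ k₀) (hk : k₀ < k)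
    (hW' : IsBrownianReal W' P') (hind : IndepFun ξ' (fun ω t ↦ W' t ω) P')
    (hE : IsEsscher (k - k₀) P ξ P' ξ') {c : ℝ} (hc : 0 ≤ c) :
    ∫⁻ ω, discount c (firstHittingTime W' ξ' k ω) ∂P' =
      ENNReal.ofReal (laplace τ P₀ ((k - k₀) * k₀ + (k - k₀) ^ 2 / 2 + c) /
        laplace ξ P (k - k₀)) := by
  have := h.isProbabilityMeasure
  have hα : 0 ≤ (k - k₀) * k₀ + (k - k₀) ^ 2 / 2 := by
    have := mul_nonneg (sub_nonneg.2 hk.le) h.slope_nonneg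
    positivity
  set α := (k - k₀) * k₀ + (k - k₀) ^ 2 / 2
  have hZ := laplace_pos h.aemeasurable_start h.start_nonneg (sub_nonneg.2 hk.le)
  -- Condition on the start, with the original `W` driving the inner hitting times, so that the
  -- hypothesis on `τ` can be used when the integral is reassembled.
  rw [lintegral_comp_firstHittingTime hW' hE.aemeasurable hind h.brownian k
    (measurable_discount c), hE.map_eq_tilted h.aemeasurable_start h.start_nonneg, lintegral_tilted,
    ← laplace_eq_integral_map h.aemeasurable_start]
  have hcongr : ∀ᵐ x ∂P.map ξ,
      ENNReal.ofReal (Real.exp (-(k - k₀) * x) / laplace ξ P (k - k₀)) *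
        ∫⁻ ω, discount c (hit x k (fun t ↦ W t ω)) ∂P =
      ENNReal.ofReal (laplace ξ P (k - k₀))⁻¹ *
        ∫⁻ ω, discount (c + α) (hit x k₀ (fun t ↦ W t ω)) ∂P := by
    filter_upwards [(ae_nonneg_map h.aemeasurable_start).2 h.start_nonneg] with x hx
    rw [lintegral_discount_hit_eq h.brownian hx h.slope_nonneg hk.le hc, ← mul_assoc,
      ← ENNReal.ofReal_mul (by positivity), div_mul_eq_mul_div, ← Real.exp_add,
      show -(k - k₀) * x + (k - k₀) * x = 0 by ring, Real.exp_zero, one_div]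
  rw [lintegral_congr_ae hcongr, lintegral_const_mul' _ _ (by simp),
    ← lintegral_comp_firstHittingTime h.brownian h.aemeasurable_start h.indep h.brownian k₀
      (measurable_discount _), h.lintegral_discount (by positivity),
    ← ENNReal.ofReal_mul (by positivity), add_comm c, inv_mul_eq_div]

lemma lintegral_discount_zero_firstHittingTime (hW : IsBrownianReal W P) (hξ : AEMeasurable ξ P)
    (hind : IndepFun ξ (fun ω t ↦ W t ω) P) (hk : 0 < k) :
    ∫⁻ ω, discount 0 (firstHittingTime W ξ k ω) ∂P = 1 := by
  have := hW.isGaussianProcess.isProbabilityMeasure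
  have := Measure.isProbabilityMeasure_map hξ
  rw [lintegral_comp_firstHittingTime hW hξ hind hW k (measurable_discount 0)]
  simp_rw [lintegral_discount_zero_hit hW _ hk]
  simp

lemma ae_firstHittingTime_ne_top (hW : IsBrownianReal W P) (hξ : AEMeasurable ξ P)
    (hind : IndepFun ξ (fun ω t ↦ W t ω) P) (hk : 0 < k) :
    ∀ᵐ ω ∂P, firstHittingTime W ξ k ω ≠ ∞ := by
  have := hW.isGaussianProcess.isProbabilityMeasure
  exact ae_ne_top_of_lintegral_discount
    (lintegral_discount_zero_firstHittingTime hW hξ hind hk)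

/-- After the Esscher transform of the starting point and the increase of the slope, the hitting
time is in the Esscher family of the original one. -/
lemma IsSolution.isEsscher_firstHittingTime (h : IsSolution P W ξ P₀ τ k₀) (hk : k₀ < k)
    (hW' : IsBrownianReal W' P') (hind : IndepFun ξ' (fun ω t ↦ W' t ω) P')
    (hE : IsEsscher (k - k₀) P ξ P' ξ') :
    IsEsscher ((k - k₀) * k₀ + (k - k₀) ^ 2 / 2) P₀ τ P'
      (fun ω ↦ (firstHittingTime W' ξ' k ω).toReal) := by
  have := h.isProbabilityMeasure
  have := h.isProbabilityMeasure_target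
  have := hE.isProbabilityMeasure
  have hk0 : 0 < k := h.slope_nonneg.trans_lt hk
  have hT := aemeasurable_firstHittingTime hW' hE.aemeasurable k
  have hα : 0 < (k - k₀) * k₀ + (k - k₀) ^ 2 / 2 := by
    have := mul_nonneg (sub_nonneg.2 hk.le) h.slope_nonneg
    have := pow_pos (sub_pos.2 hk) 2
    positivity
  have hZ := laplace_pos h.aemeasurable_start h.start_nonneg (sub_nonneg.2 hk.le)
  -- The case `c = 0`: hitting is almost sure, so the quotient of the two normalising constants is
  -- `1`.
  have hnorm : laplace τ P₀ ((k - k₀) * k₀ + (k - k₀) ^ 2 / 2) = laplace ξ P (k - k₀) := by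
    have h1 := h.lintegral_discount_of_isEsscher hk hW' hind hE le_rfl
    rw [lintegral_discount_zero_firstHittingTime hW' hE.aemeasurable hind hk0, eq_comm,
      ENNReal.ofReal_eq_one, div_eq_one_iff_eq hZ.ne', add_zero] at h1
    exact h1
  refine ⟨hα, inferInstance, hT.ennreal_toReal, fun s hs ↦ ?_⟩
  have h2 := h.lintegral_discount_of_isEsscher hk hW' hind hE hs
  rw [lintegral_discount_eq_laplace hT (ae_firstHittingTime_ne_top hW' hE.aemeasurable hind hk0) hs,
    ENNReal.ofReal_eq_ofReal_iff (laplace_pos hT.ennreal_toReal (by simp) hs).le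
      (div_nonneg (laplace_pos h.aemeasurable_target h.target_nonneg (by positivity)).le hZ.le)]
    at h2
  rw [h2, hnorm]

lemma IsSolution.of_isEsscher {Ω₁ : Type*} [MeasurableSpace Ω₁] {P₁ : Measure Ω₁} {τ' : Ω₁ → ℝ}
    (h : IsSolution P W ξ P₀ τ k₀) (hk : k₀ < k)
    (hW' : IsBrownianReal W' P') (hind : IndepFun ξ' (fun ω t ↦ W' t ω) P')
    (hE : IsEsscher (k - k₀) P ξ P' ξ')
    (hE' : IsEsscher ((k - k₀) * k₀ + (k - k₀) ^ 2 / 2) P₀ τ P₁ τ') :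
    IsSolution P' W' ξ' P₁ τ' k := by
  have := h.isProbabilityMeasure
  have := h.isProbabilityMeasure_target
  have hk0 : 0 < k := h.slope_nonneg.trans_lt hk
  have hT := aemeasurable_firstHittingTime hW' hE.aemeasurable k
  have hlaw : P'.map (fun ω ↦ (firstHittingTime W' ξ' k ω).toReal) = P₁.map τ' :=
    ((h.isEsscher_firstHittingTime hk hW' hind hE).map_eq_tilted h.aemeasurable_target
      h.target_nonneg).trans (hE'.map_eq_tilted h.aemeasurable_target h.target_nonneg).symm
  refine ⟨hE.isProbabilityMeasure, hE'.isProbabilityMeasure, hW', hE.aemeasurable,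
    hE.ae_nonneg h.aemeasurable_start h.start_nonneg, hind, hk0.le, hE'.aemeasurable,
    hE'.ae_nonneg h.aemeasurable_target h.target_nonneg, fun t ↦ ?_⟩
  have h1 := congrArg (fun μ ↦ μ (Set.Iic (t : ℝ))) hlaw
  rw [Measure.map_apply_of_aemeasurable hT.ennreal_toReal measurableSet_Iic,
    Measure.map_apply_of_aemeasurable hE'.aemeasurable measurableSet_Iic] at h1
  -- `toReal` sends `∞` to `0`, so the two events agree only where the hitting time is finite.
  refine Eq.trans (measure_congr ?_) h1
  filter_upwards [ae_firstHittingTime_ne_top hW' hE.aemeasurable hind hk0] with ω hω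
  refine propext ?_
  change firstHittingTime W' ξ' k ω ≤ t ↔ (firstHittingTime W' ξ' k ω).toReal ≤ t
  lift firstHittingTime W' ξ' k ω to ℝ≥0 using hω with T
  simp

/-- A Brownian motion together with an independent variable of prescribed distribution. -/
lemma isBrownianReal_comp_snd (hW : IsBrownianReal W P) (μ : Measure ℝ) [IsProbabilityMeasure μ] :
    IsBrownianReal (fun t (p : ℝ × Ω) ↦ W t p.2) (μ.prod P) := by
  have := hW.isGaussianProcess.isProbabilityMeasure
  have hsnd : MeasurePreserving Prod.snd (μ.prod P) P := measurePreserving_snd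
  exact ⟨⟨fun I ↦ (hW.hasLaw I).comp hsnd.hasLaw⟩, hsnd.quasiMeasurePreserving.ae hW.cont⟩

/-- The product formula for rectangles holds for arbitrary sets, so the path map, whose coordinates
are only almost everywhere measurable, is allowed as `f`. -/
lemma indepFun_fst_comp_snd {β : Type*} [MeasurableSpace β] (μ : Measure ℝ)
    [IsProbabilityMeasure μ] [IsProbabilityMeasure P] (f : Ω → β) :
    IndepFun (fun p : ℝ × Ω ↦ p.1) (fun p ↦ f p.2) (μ.prod P) := by
  rw [indepFun_iff_measure_inter_preimage_eq_mul]
  intro s t _ _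
  have h1 : (fun p : ℝ × Ω ↦ p.1) ⁻¹' s = s ×ˢ Set.univ := by ext; simp
  have h2 : (fun p : ℝ × Ω ↦ f p.2) ⁻¹' t = Set.univ ×ˢ (f ⁻¹' t) := by ext; simp
  rw [h1, h2, Set.prod_inter_prod, Measure.prod_prod, Measure.prod_prod, Measure.prod_prod]
  simp

lemma isEsscher_fst [IsProbabilityMeasure P] (hξ : AEMeasurable ξ P) (h0 : ∀ᵐ ω ∂P, 0 ≤ ξ ω)
    {a : ℝ} (ha : 0 < a) :
    IsEsscher a P ξ (((P.map ξ).tilted fun x ↦ -a * x).prod P) (fun p : ℝ × Ω ↦ p.1) := by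
  have := isProbabilityMeasure_tilted_map hξ h0 ha.le
  refine ⟨ha, inferInstance, by fun_prop, fun s _ ↦ ?_⟩
  rw [laplace_eq_integral_map (by fun_prop)]
  change ∫ x, _ ∂(Measure.map Prod.fst _) = _
  rw [measurePreserving_fst.map_eq, integral_exp_tilted, laplace_eq_integral_map hξ,
    laplace_eq_integral_map hξ]

end Solution

end GSP

theorem proposition3
    {Ω : Type u} [MeasurableSpace Ω] (P : Measure Ω) (W : ℝ≥0 → Ω → ℝ) (ξ : Ω → ℝ)
    {Ω₀ : Type v} [MeasurableSpace Ω₀] (P₀ : Measure Ω₀) (τ : Ω₀ → ℝ)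
    (k₀ : ℝ) (h : GSP.IsSolution P W ξ P₀ τ k₀) (k : ℝ) (hk : k₀ < k) :
    ∃ α β : ℝ, α = (k - k₀) * k₀ + (k - k₀) ^ 2 / 2 ∧ β = k - k₀ ∧
      -- there are such Esscher variables, and they form a solution with slope `k`
      (∃ (Ω' : Type u) (_ : MeasurableSpace Ω') (P' : Measure Ω') (W' : ℝ≥0 → Ω' → ℝ)
          (ξβ τα : Ω' → ℝ),
        GSP.IsEsscher β P ξ P' ξβ ∧ GSP.IsEsscher α P₀ τ P' τα ∧
          GSP.IsSolution P' W' ξβ P' τα k) ∧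
      -- and any such Esscher variables form a solution, for every Brownian motion
      -- independent of the starting point
      (∀ (Ω' : Type w) (_ : MeasurableSpace Ω') (P' : Measure Ω') (W' : ℝ≥0 → Ω' → ℝ)
          (ξβ : Ω' → ℝ) (Ω₁ : Type z) (_ : MeasurableSpace Ω₁) (P₁ : Measure Ω₁) (τα : Ω₁ → ℝ),
        IsBrownianReal W' P' → IndepFun ξβ (fun ω t ↦ W' t ω) P' →
        GSP.IsEsscher β P ξ P' ξβ → GSP.IsEsscher α P₀ τ P₁ τα →
          GSP.IsSolution P' W' ξβ P₁ τα k) := by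
  refine ⟨_, _, rfl, rfl, ?_, fun Ω' _ P' W' ξβ Ω₁ _ P₁ τα hW' hind hE hE' ↦
    h.of_isEsscher hk hW' hind hE hE'⟩
  have := h.isProbabilityMeasure
  have := GSP.isProbabilityMeasure_tilted_map h.aemeasurable_start h.start_nonneg
    (sub_pos.2 hk).le
  have hE := GSP.isEsscher_fst h.aemeasurable_start h.start_nonneg (sub_pos.2 hk)
  have hW' := GSP.isBrownianReal_comp_snd h.brownian
    ((P.map ξ).tilted fun x ↦ -(k - k₀) * x)
  have hind := GSP.indepFun_fst_comp_snd (P := P)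
    ((P.map ξ).tilted fun x ↦ -(k - k₀) * x) (fun ω t ↦ W t ω)
  have hE' := h.isEsscher_firstHittingTime hk hW' hind hE
  -- The start is the first coordinate under the tilted law, the Brownian motion lives on the
  -- second, and `τα` is the hitting time itself.
  exact ⟨ℝ × Ω, inferInstance, _, _, _, _, hE, hE', h.of_isEsscher hk hW' hind hE hE'⟩
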